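/- Let $(M,g)$ be an oriented Riemannian surface with a spin structure, spinor bundle $\Sigma M$ (a Hermitian complex rank-2 bundle with Clifford multiplication $X\cdot Y\cdot\psi+Y\cdot X\cdot\psi=-2g(X,Y)\psi$), Levi-Civita spin connection $\nabla$, Dirac operator $D\psi=\sum_{\alpha=1}^2 e_\alpha\cdot\nabla_{e_\alpha}\psi$ for a local orthonormal frame $(e_1,e_2)$, and Gaussian curvature $K_g$. The super-Liouville system for a smooth function $u:M\to\mathbb R$ and a smooth spinor $\psi$ is $$-\Delta u=2e^{2u}-e^{u}|\psi|^2-K_g,\qquad D\psi=-e^{u}\psi\qquad\text{on }M.$$ A Killing spinor with Killing constant $\lambda$ is a smooth spinor $\psi$ with $\nabla_X\psi=\lambda\,X\cdot\psi$ for every tangent vector $X$. **Proposition.** (a) Let $M=\mathbb S^2$ be the round unit sphere, $K_g=1$, and let $\psi$ be a Killing spinor with Killing constant $\lambda=\tfrac12$ and $|\psi|=1$. Then $(0,\psi)$ is a solution of the super-Liouville system on $\mathbb S^2$. (b) Let $v\in\mathbb C^2$ with $|v|=1$, and let $$u(x)=\log\frac{2}{1+|x|^2},\qquad \psi_v(x)=\sqrt2\,\frac{v+x\cdot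 v}{1+|x|^2}\qquad(x\in\mathbb R^2),$$ where $x\cdot v=x_1e_1v+x_2e_2v$ with $e_1=\begin{pmatrix}0&1\\-1&0\end{pmatrix}$, $e_2=\begin{pmatrix}0&i\\i&0\end{pmatrix}$. Then $(u,\psi_v)$ is a solution of the super-Liouville system on $\mathbb R^2$ with the Euclidean metric (so $K_g=0$). (c) The solutions in (a) and (b) correspond to each other under stereographic projection. Identify $\mathbb S^2\setminus\{\text{north pole}\}$ with $\mathbb R^2$ carrying the metric $\rho^2|dx|^2$, $\rho(x)=\frac{2}{1+|x|^2}$, and write spinors in the orthonormal frame $\rho^{-1}\partial_1,\rho^{-1}\partial_2$ (with a fixed lift to the spin structure). Then a map $\varphi:\mathbb R^2\to\mathbb C^2$ is of the form $\varphi=\sqrt\rho\,\psi$ for a Killing spinor $\psi$ on $\mathbb S^2$ with Killing constant $\tfrac12$ and $|\psi|=1$ if and only if $\varphi=\psi_v$ for some $v\in\mathbb C^2$ with $|v|=1$. Thus the pairs $(u,\psi_v)$ are exactly the conformal images $(0+\log\rho,\sqrt\rho\,\psi)$ of the pairs $(0,\psi)$. -/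

import Mathlib

open scoped ContDiff InnerProductSpace ComplexConjugate

noncomputable section

namespace SuperLiouville

/-! ## The spinor module of the Euclidean plane -/

/-- The two-dimensional spinor module `ℂ²` with its Hermitian metric. -/
abbrev Spinor : Type := EuclideanSpace ℂ (Fin 2)

/-- Clifford multiplication by the first vector of an oriented orthonormal frame. -/
def gammaOne : Matrix (Fin 2) (Fin 2) ℂ := !![0, 1; -1, 0]

/-- Clifford multiplication by the second vector of an oriented orthonormal frame. -/
def gammaTwo : Matrix (Fin 2) (Fin 2) ℂ := !![0, Complex.I; Complex.I, 0]

/-- A matrix acting on a spinor. -/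
def act (A : Matrix (Fin 2) (Fin 2) ℂ) (φ : Spinor) : Spinor :=
  WithLp.toLp 2 (A.mulVec (WithLp.ofLp φ))

/-- Clifford multiplication `x · φ = x₁ e₁ · φ + x₂ e₂ · φ` by the vector `x = x₁ + i x₂` of the
Euclidean plane, which is identified with `ℂ`. -/
def cliff (x : ℂ) (φ : Spinor) : Spinor :=
  x.re • act gammaOne φ + x.im • act gammaTwo φ

/-- The action of the element `s` of `Spin(2) = U(1)`, which covers the rotation by `s ^ 2`, on
spinors: `s` on the positive and `conj s` on the negative half-spinors. It satisfies
`s (x · φ) = (s ^ 2 x) · (s φ)`. -/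
def spinAct (s : ℂ) (φ : Spinor) : Spinor :=
  act !![s, 0; 0, conj s] φ

/-! ## Riemannian surfaces with a spin structure -/

/-- An oriented Riemannian surface with a spin structure, presented by isothermal charts. In the
chart `i` the metric is `ρ i ^ 2 |dz|²`, and the chart carries the oriented orthonormal frame
`e₁ = ρ⁻¹ ∂₁`, `e₂ = ρ⁻¹ ∂₂`. The transition maps `τ` are holomorphic isometries. Passing from the
chart `i` to the chart `j` rotates the frame components by `τ' / |τ'|`, and the spin structure is a
lift of this `SO(2)`-cocycle to a `Spin(2)`-cocycle along `s ↦ s ^ 2`. -/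
structure SpinSurface (M : Type*) [TopologicalSpace M] where
  ι : Type
  chart : ι → OpenPartialHomeomorph M ℂ
  cover : ∀ p : M, ∃ i, p ∈ (chart i).source
  ρ : ι → ℂ → ℝ
  ρ_pos : ∀ i, ∀ z ∈ (chart i).target, 0 < ρ i z
  ρ_smooth : ∀ i, ContDiffOn ℝ ∞ (ρ i) (chart i).target
  holomorphic : ∀ i j, DifferentiableOn ℂ (fun z => chart j ((chart i).symm z))
    ((chart i).symm.trans (chart j)).source
  isometric : ∀ i j, ∀ z ∈ ((chart i).symm.trans (chart j)).source,
    ρ i z = ρ j (chart j ((chart i).symm z)) * ‖deriv (fun z => chart j ((chart i).symm z)) z‖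
  lift : ι → ι → ℂ → ℂ
  lift_continuous : ∀ i j, ContinuousOn (lift i j) ((chart i).symm.trans (chart j)).source
  lift_sq : ∀ i j, ∀ z ∈ ((chart i).symm.trans (chart j)).source,
    lift i j z ^ 2 = deriv (fun z => chart j ((chart i).symm z)) z
      / (‖deriv (fun z => chart j ((chart i).symm z)) z‖ : ℂ)
  lift_cocycle : ∀ i j k, ∀ z ∈ (chart i).target,
    (chart i).symm z ∈ (chart j).source → (chart i).symm z ∈ (chart k).source →
    lift j k (chart j ((chart i).symm z)) * lift i j z = lift i k z

variable {M : Type*} [TopologicalSpace M]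

/-- A section of the spinor bundle, given by its components in the charts. Values of `loc i` outside
the target of the chart `i` have no meaning. -/
structure SpinorField (S : SpinSurface M) where
  loc : S.ι → ℂ → Spinor
  glue : ∀ i j, ∀ z ∈ ((S.chart i).symm.trans (S.chart j)).source,
    loc j (S.chart j ((S.chart i).symm z)) = spinAct (S.lift i j z) (loc i z)

namespace SpinSurface

variable (S : SpinSurface M)

/-- The Laplace-Beltrami operator `Δ_g u = ρ⁻² (∂₁² u + ∂₂² u)` at the point with coordinate `z` in
the chart `i`. -/
def laplaceBeltrami (u : M → ℝ) (i : S.ι) (z : ℂ) : ℝ :=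
  (S.ρ i z ^ 2)⁻¹ * Laplacian.laplacian (fun w => u ((S.chart i).symm w)) z

/-- The Gaussian curvature `K = - ρ⁻² (∂₁² + ∂₂²) log ρ` of the metric `ρ² |dz|²`. -/
def gaussCurvature (i : S.ι) (z : ℂ) : ℝ :=
  -((S.ρ i z ^ 2)⁻¹ * Laplacian.laplacian (fun w => Real.log (S.ρ i w)) z)

/-- The Levi-Civita connection form `ω(X) = g(∇_X e₁, e₂)` of the frame `e₁ = ρ⁻¹ ∂₁`,
`e₂ = ρ⁻¹ ∂₂` on the coordinate vector `X = X₁ ∂₁ + X₂ ∂₂`, `X = X₁ + i X₂`. The torsion-free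
condition `d(ρ dx₁) = ω ∧ ρ dx₂`, `d(ρ dx₂) = - ω ∧ ρ dx₁` means
`ω = - ∂₂ (log ρ) dx₁ + ∂₁ (log ρ) dx₂`. -/
def connForm (i : S.ι) (z X : ℂ) : ℝ :=
  -(fderiv ℝ (fun w => Real.log (S.ρ i w)) z Complex.I) * X.re
    + fderiv ℝ (fun w => Real.log (S.ρ i w)) z 1 * X.im

/-- Clifford multiplication by the coordinate vector `X`, whose components in the orthonormal frame
are those of `ρ X`. -/
def clifford (i : S.ι) (z X : ℂ) (φ : Spinor) : Spinor :=
  cliff (S.ρ i z • X) φ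

/-- A function on the surface is smooth. -/
def SmoothFunction (u : M → ℝ) : Prop :=
  ∀ i, ContDiffOn ℝ ∞ (fun z => u ((S.chart i).symm z)) (S.chart i).target

end SpinSurface

namespace SpinorField

variable {S : SpinSurface M} (ψ : SpinorField S)

/-- The section is smooth. -/
def Smooth : Prop := ∀ i, ContDiffOn ℝ ∞ (ψ.loc i) (S.chart i).target

/-- The pointwise norm is constantly equal to one. -/
def UnitNorm : Prop := ∀ i, ∀ z ∈ (S.chart i).target, ‖ψ.loc i z‖ = 1

/-- The spin connection `∇_X ψ = X ψ + ½ g(∇_X e₁, e₂) e₁ · e₂ · ψ` induced by the Levi-Civita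
connection, for the coordinate vector `X`. -/
def nabla (i : S.ι) (z X : ℂ) : Spinor :=
  fderiv ℝ (ψ.loc i) z X
    + (S.connForm i z X / 2) • act gammaOne (act gammaTwo (ψ.loc i z))

/-- The Dirac operator `D ψ = e₁ · ∇_{e₁} ψ + e₂ · ∇_{e₂} ψ` for `e₁ = ρ⁻¹ ∂₁`, `e₂ = ρ⁻¹ ∂₂`. -/
def dirac (i : S.ι) (z : ℂ) : Spinor :=
  act gammaOne (ψ.nabla i z ((S.ρ i z)⁻¹ • (1 : ℂ)))
    + act gammaTwo (ψ.nabla i z ((S.ρ i z)⁻¹ • Complex.I))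

/-- A Killing spinor with Killing constant `c`: a smooth section with `∇_X ψ = c X · ψ` for every
tangent vector `X`. -/
def IsKilling (c : ℂ) : Prop :=
  ψ.Smooth ∧ ∀ i, ∀ z ∈ (S.chart i).target, ∀ X : ℂ,
    ψ.nabla i z X = c • S.clifford i z X (ψ.loc i z)

end SpinorField

/-- `(u, ψ)` is a smooth solution of the super-Liouville system
`-Δ u = 2 e^{2u} - e^u ⟨ψ, ψ⟩ - K`, `D ψ = - e^u ψ` on the surface. -/
def IsSolution (S : SpinSurface M) (u : M → ℝ) (ψ : SpinorField S) : Prop :=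
  S.SmoothFunction u ∧ ψ.Smooth ∧
    ∀ i, ∀ z ∈ (S.chart i).target,
      -S.laplaceBeltrami u i z
          = 2 * Real.exp (2 * u ((S.chart i).symm z))
            - Real.exp (u ((S.chart i).symm z)) * ‖ψ.loc i z‖ ^ 2 - S.gaussCurvature i z
        ∧ ψ.dirac i z = -(Real.exp (u ((S.chart i).symm z)) • ψ.loc i z)

/-! ## The Euclidean plane -/

/-- The plane `ℝ² = ℂ` with the metric `|dz|²` and its spin structure. -/
def euclideanPlane : SpinSurface ℂ where
  ι := Unit
  chart _ := OpenPartialHomeomorph.refl ℂ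
  cover _ := ⟨(), by simp⟩
  ρ _ _ := 1
  ρ_pos := by simp
  ρ_smooth _ := contDiffOn_const
  holomorphic _ _ := differentiableOn_id.congr (by simp)
  isometric _ _ := by simp
  lift _ _ _ := 1
  lift_continuous _ _ := continuousOn_const
  lift_sq _ _ := by simp
  lift_cocycle := by simp

/-- A spinor field on the Euclidean plane is a map to `ℂ²`. -/
def planeField (f : ℂ → Spinor) : SpinorField euclideanPlane where
  loc _ := f
  glue _ _ z _ := by
    ext k
    fin_cases k <;> simp [euclideanPlane, spinAct, act, dotProduct, Fin.sum_univ_two]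

/-! ## The round sphere -/

/-- The unit sphere in `ℝ³`. -/
abbrev Sphere : Type := Metric.sphere (0 : EuclideanSpace ℝ (Fin 3)) 1

/-- The two poles from which the sphere is projected. -/
inductive Pole : Type
  | north : Pole
  | south : Pole

/-- The height of a pole. -/
def Pole.sign : Pole → ℝ
  | .north => 1
  | .south => -1

/-- The conformal factor of the round metric `4 / (1 + |z|²)² |dz|²` in a stereographic chart. -/
def roundFactor (z : ℂ) : ℝ := 2 / (1 + ‖z‖ ^ 2)

/-- Stereographic projection from a pole onto the equatorial plane. From the north pole it is
`p ↦ (p₁ + i p₂) / (1 - p₃)`, and from the south pole, followed by a conjugation which makes the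
two charts equally oriented, it is `p ↦ (p₁ - i p₂) / (1 + p₃)`. -/
def stereoProj (a : Pole) (p : EuclideanSpace ℝ (Fin 3)) : ℂ :=
  ⟨p 0 / (1 - a.sign * p 2), a.sign * p 1 / (1 - a.sign * p 2)⟩

/-- The inverse of stereographic projection. -/
def stereoInv (a : Pole) (z : ℂ) : EuclideanSpace ℝ (Fin 3) :=
  !₂[2 * z.re / (1 + ‖z‖ ^ 2), a.sign * (2 * z.im / (1 + ‖z‖ ^ 2)),
    a.sign * ((‖z‖ ^ 2 - 1) / (1 + ‖z‖ ^ 2))]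

lemma sign_mul_self (a : Pole) : a.sign * a.sign = 1 := by cases a <;> norm_num [Pole.sign]

lemma norm_sq_eq (z : ℂ) : ‖z‖ ^ 2 = z.re ^ 2 + z.im ^ 2 := by
  rw [← Complex.normSq_eq_norm_sq, Complex.normSq_apply]; ring

lemma one_add_pos (z : ℂ) : 0 < 1 + ‖z‖ ^ 2 := by positivity

lemma sphere_eq (p : Sphere) : p.1 0 ^ 2 + p.1 1 ^ 2 + p.1 2 ^ 2 = 1 := by
  have h := p.2
  rw [mem_sphere_zero_iff_norm] at h
  have h2 := EuclideanSpace.norm_sq_eq p.1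
  rw [h, Fin.sum_univ_three] at h2
  simp only [Real.norm_eq_abs, sq_abs] at h2
  linarith

lemma stereoInv_mem (a : Pole) (z : ℂ) :
    stereoInv a z ∈ Metric.sphere (0 : EuclideanSpace ℝ (Fin 3)) 1 := by
  rw [mem_sphere_zero_iff_norm, ← sq_eq_sq₀ (norm_nonneg _) zero_le_one, EuclideanSpace.norm_sq_eq,
    Fin.sum_univ_three]
  have h := one_add_pos z
  have hs := sign_mul_self a
  simp only [stereoInv, Real.norm_eq_abs, sq_abs, PiLp.toLp_apply, Matrix.cons_val]
  rw [norm_sq_eq] at h ⊢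
  field_simp
  linear_combination (4 * z.im ^ 2 + (z.re ^ 2 + z.im ^ 2 - 1) ^ 2) * hs

lemma one_sub_ne (z : ℂ) : 1 - (‖z‖ ^ 2 - 1) / (1 + ‖z‖ ^ 2) ≠ 0 := by
  have h := one_add_pos z
  rw [show 1 - (‖z‖ ^ 2 - 1) / (1 + ‖z‖ ^ 2) = 2 / (1 + ‖z‖ ^ 2) by field_simp; ring]
  positivity

/-- The stereographic chart of the sphere centred opposite to the pole `a`. -/
def stereoChart (a : Pole) : OpenPartialHomeomorph Sphere ℂ where
  toFun p := stereoProj a p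
  invFun z := ⟨stereoInv a z, stereoInv_mem a z⟩
  source := {p | 1 - a.sign * p.1 2 ≠ 0}
  target := Set.univ
  map_source' _ _ := Set.mem_univ _
  map_target' z _ := by
    have h := one_sub_ne z
    simpa [stereoInv, ← mul_assoc, sign_mul_self] using h
  left_inv' p hp := by
    have hp' : 1 - a.sign * p.1 2 ≠ 0 := hp
    have hs := sign_mul_self a
    have h1 := sphere_eq p
    have h2 : (1 + ‖stereoProj a p.1‖ ^ 2) * (1 - a.sign * p.1 2) = 2 := by
      rw [norm_sq_eq]
      simp only [stereoProj]
      field_simp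
      linear_combination h1 + (p.1 1 ^ 2 + p.1 2 ^ 2) * hs
    have h3 : 1 + ‖stereoProj a p.1‖ ^ 2 = 2 / (1 - a.sign * p.1 2) := by
      rw [eq_div_iff hp']; exact h2
    have h4 : ‖stereoProj a p.1‖ ^ 2 = 2 / (1 - a.sign * p.1 2) - 1 := by linarith
    apply Subtype.ext
    ext k
    fin_cases k
    · simp only [stereoInv, h3]
      simp [stereoProj]
      field_simp
    · simp only [stereoInv, h3]
      simp [stereoProj]
      field_simp
      linear_combination (p.1 1) * hs
    · simp only [stereoInv, h4]
      simp
      field_simp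
      linear_combination 2 * (p.1 2) * hs
  right_inv' z _ := by
    have h := one_sub_ne z
    have h' := one_add_pos z
    have hs := sign_mul_self a
    have h2 : 1 - (‖z‖ ^ 2 - 1) / (1 + ‖z‖ ^ 2) = 2 / (1 + ‖z‖ ^ 2) := by field_simp; ring
    apply Complex.ext
    · simp [stereoProj, stereoInv, ← mul_assoc, hs, h2]
      field_simp
    · simp [stereoProj, stereoInv, ← mul_assoc, hs, h2]
      field_simp
  open_source := by
    apply isOpen_ne_fun <;> fun_prop
  open_target := isOpen_univ
  continuousOn_toFun := by
    have h : (fun p : Sphere => stereoProj a p)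
        = fun p : Sphere => ((p.1 0 / (1 - a.sign * p.1 2) : ℝ) : ℂ)
          + ((a.sign * p.1 1 / (1 - a.sign * p.1 2) : ℝ) : ℂ) * Complex.I := by
      funext p
      exact Complex.mk_eq_add_mul_I _ _
    rw [h]
    have h0 : ∀ p ∈ {p : Sphere | 1 - a.sign * p.1 2 ≠ 0}, 1 - a.sign * p.1 2 ≠ 0 := fun _ hp => hp
    apply ContinuousOn.add
    · apply Complex.continuous_ofReal.comp_continuousOn
      apply ContinuousOn.div (by fun_prop) (by fun_prop) h0
    · apply ContinuousOn.mul _ continuousOn_const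
      apply Complex.continuous_ofReal.comp_continuousOn
      apply ContinuousOn.div (by fun_prop) (by fun_prop) h0
  continuousOn_invFun := by
    have h0 : ∀ z : ℂ, 1 + ‖z‖ ^ 2 ≠ 0 := fun z => (one_add_pos z).ne'
    apply Continuous.continuousOn
    apply Continuous.subtype_mk
    unfold stereoInv
    apply (PiLp.continuous_toLp 2 _).comp
    apply continuous_pi
    intro k
    fin_cases k
    · exact (by fun_prop : Continuous fun z : ℂ => 2 * z.re).div (by fun_prop) h0
    · exact continuous_const.mul ((by fun_prop : Continuous fun z : ℂ => 2 * z.im).div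
        (by fun_prop) h0)
    · exact continuous_const.mul ((by fun_prop : Continuous fun z : ℂ => ‖z‖ ^ 2 - 1).div
        (by fun_prop) h0)

/-- The metric `roundFactor² |dz|²` is the one which the stereographic parametrization induces from
the Euclidean metric of `ℝ³`. -/
lemma norm_fderiv_stereoInv (a : Pole) (z h : ℂ) :
    ‖fderiv ℝ (stereoInv a) z h‖ = roundFactor z * ‖h‖ := by
  have hq : ∀ w : ℂ, HasFDerivAt (fun z : ℂ => 1 + ‖z‖ ^ 2)
      ((2 * w.re) • Complex.reCLM + (2 * w.im) • Complex.imCLM) w := by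
    intro w
    have h1 := ((Complex.reCLM.hasFDerivAt (x := w)).pow 2).add
      ((Complex.imCLM.hasFDerivAt (x := w)).pow 2)
    refine ((h1.const_add 1).congr_of_eventuallyEq (.of_forall fun y => ?_)).congr_fderiv ?_
    · simp [norm_sq_eq]
    · ext <;> simp
  have h0 : (1 + ‖z‖ ^ 2) ≠ 0 := (one_add_pos z).ne'
  have hi : HasFDerivAt (fun z : ℂ => (1 + ‖z‖ ^ 2)⁻¹) _ z :=
    (hasDerivAt_inv h0).comp_hasFDerivAt z (hq z)
  have e0 := ((Complex.reCLM.hasFDerivAt (x := z)).const_mul 2).mul hi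
  have e1 := (((Complex.imCLM.hasFDerivAt (x := z)).const_mul 2).mul hi).const_mul a.sign
  have e2 := (((hq z).sub_const 2).mul hi).const_mul a.sign
  have c0 : HasFDerivAt (fun w => stereoInv a w 0) _ z :=
    e0.congr_of_eventuallyEq (.of_forall fun y => by simp [stereoInv, div_eq_mul_inv])
  have c1 : HasFDerivAt (fun w => stereoInv a w 1) _ z :=
    e1.congr_of_eventuallyEq (.of_forall fun y => by simp [stereoInv, div_eq_mul_inv])
  have c2 : HasFDerivAt (fun w => stereoInv a w 2) _ z :=
    e2.congr_of_eventuallyEq (.of_forall fun y => by simp [stereoInv, div_eq_mul_inv]; ring_nf; simp)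
  have hd : DifferentiableAt ℝ (stereoInv a) z := by
    rw [differentiableAt_euclidean]
    intro k
    fin_cases k
    · exact c0.differentiableAt
    · exact c1.differentiableAt
    · exact c2.differentiableAt
  have hk : ∀ k, HasFDerivAt (fun w => stereoInv a w k) _ z := fun k =>
    (EuclideanSpace.proj k : EuclideanSpace ℝ (Fin 3) →L[ℝ] ℝ).hasFDerivAt.comp z hd.hasFDerivAt
  have d0 := congrArg (fun l => l h) ((hk 0).unique c0)
  have d1 := congrArg (fun l => l h) ((hk 1).unique c1)
  have d2 := congrArg (fun l => l h) ((hk 2).unique c2)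
  simp at d0 d1 d2
  have hp : 0 ≤ roundFactor z * ‖h‖ :=
    mul_nonneg (div_nonneg two_pos.le (one_add_pos z).le) (norm_nonneg _)
  rw [← sq_eq_sq₀ (norm_nonneg _) hp, EuclideanSpace.norm_sq_eq, Fin.sum_univ_three]
  simp only [Real.norm_eq_abs, sq_abs, d0, d1, d2, mul_pow, roundFactor, norm_sq_eq h]
  rw [norm_sq_eq z] at h0 ⊢
  cases a <;> simp only [Pole.sign] <;> field_simp <;> ring

/-- The coordinate change between two stereographic charts. -/
def stereoChange : Pole → Pole → ℂ → ℂ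
  | .north, .north, z => z
  | .south, .south, z => z
  | .north, .south, z => z⁻¹
  | .south, .north, z => z⁻¹

lemma stereoChange_self (a : Pole) : stereoChange a a = id := by cases a <;> rfl

lemma stereoChart_trans (a b : Pole) :
    (fun z => stereoChart b ((stereoChart a).symm z)) = stereoChange a b := by
  funext z
  have h : ∀ c : Pole, stereoChart c ((stereoChart c).symm z) = z :=
    fun c => (stereoChart c).right_inv (Set.mem_univ z)
  have h' := one_add_pos z
  have key : ∀ a b : Pole, b.sign = -a.sign →
      stereoChart b ((stereoChart a).symm z) = z⁻¹ := by
    intro a b hab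
    have hs := sign_mul_self a
    have h2 : 1 + (‖z‖ ^ 2 - 1) / (1 + ‖z‖ ^ 2) = 2 * ‖z‖ ^ 2 / (1 + ‖z‖ ^ 2) := by
      field_simp; ring
    change stereoProj b (stereoInv a z) = z⁻¹
    have hn : Complex.normSq z = ‖z‖ ^ 2 := Complex.normSq_eq_norm_sq z
    rcases eq_or_ne z 0 with rfl | hz
    · apply Complex.ext <;> simp [stereoProj, stereoInv]
    · have hz' : ‖z‖ ≠ 0 := norm_ne_zero_iff.2 hz
      apply Complex.ext
      · simp [stereoProj, stereoInv, ← mul_assoc, hab, hs, h2, Complex.inv_re, hn]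
        field_simp
      · simp [stereoProj, stereoInv, ← mul_assoc, hab, hs, h2, Complex.inv_im, hn]
        field_simp
  cases a <;> cases b
  · exact h _
  · exact key _ _ (by simp [Pole.sign])
  · exact key _ _ (by simp [Pole.sign])
  · exact h _

lemma zero_notMem_overlap (a b : Pole) (z : ℂ)
    (hz : (stereoChart a).symm z ∈ (stereoChart b).source) : a = b ∨ z ≠ 0 := by
  rcases eq_or_ne z 0 with rfl | h
  · left
    have h1 : 1 - b.sign * (stereoInv a 0) 2 ≠ 0 := hz
    cases a <;> cases b <;> simp [stereoInv, Pole.sign] at h1 ⊢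
  · exact Or.inr h

/-- The `Spin(2)`-cocycle of the spin structure of the sphere: the frames of the two stereographic
charts differ by the rotation by `(z⁻¹)' / |(z⁻¹)'| = (± i conj z / |z|) ^ 2`. -/
def roundLift : Pole → Pole → ℂ → ℂ
  | .north, .north, _ => 1
  | .south, .south, _ => 1
  | .north, .south, z => Complex.I * conj z / (‖z‖ : ℂ)
  | .south, .north, z => -(Complex.I * conj z / (‖z‖ : ℂ))

/-- The round sphere with its spin structure. -/
def roundSphere : SpinSurface Sphere where
  ι := Pole
  chart := stereoChart
  cover p := by
    by_cases h : p.1 2 = 1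
    · exact ⟨Pole.south, by simp [stereoChart, Pole.sign, h]⟩
    · exact ⟨Pole.north, by simpa [stereoChart, Pole.sign, sub_eq_zero] using Ne.symm h⟩
  ρ _ := roundFactor
  ρ_pos _ z _ := div_pos two_pos (one_add_pos z)
  ρ_smooth _ := by
    apply ContDiff.contDiffOn
    exact contDiff_const.div (contDiff_const.add (contDiff_norm_sq ℝ)) fun z => (one_add_pos z).ne'
  holomorphic a b := by
    rw [stereoChart_trans]
    intro z hz
    have h0 := zero_notMem_overlap a b z hz.2
    apply DifferentiableAt.differentiableWithinAt
    cases a <;> cases b <;> simp at h0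
    · exact differentiableAt_id
    · exact differentiableAt_inv h0
    · exact differentiableAt_inv h0
    · exact differentiableAt_id
  isometric a b z hz := by
    rw [stereoChart_trans]
    have : stereoChart b ((stereoChart a).symm z) = stereoChange a b z :=
      congrFun (stereoChart_trans a b) z
    rw [this]
    have h0 := zero_notMem_overlap a b z hz.2
    have key : z ≠ 0 → roundFactor z = roundFactor z⁻¹ * ‖deriv (fun z : ℂ => z⁻¹) z‖ := by
      intro h
      have hz' : ‖z‖ ≠ 0 := norm_ne_zero_iff.2 h
      have h1 := one_add_pos z
      rw [deriv_inv]
      simp only [roundFactor, norm_inv, norm_neg, norm_pow]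
      field_simp
      ring
    cases a <;> cases b <;> simp at h0
    · simp [stereoChange_self]
    · exact key h0
    · exact key h0
    · simp [stereoChange_self]
  lift := roundLift
  lift_continuous a b := by
    intro z hz
    have h0 := zero_notMem_overlap a b z hz.2
    apply ContinuousAt.continuousWithinAt
    have key : z ≠ 0 → ContinuousAt (fun z : ℂ => Complex.I * conj z / (‖z‖ : ℂ)) z := by
      intro h
      apply ContinuousAt.div (by fun_prop) (by fun_prop)
      simpa using h
    cases a <;> cases b <;> simp at h0
    · exact continuousAt_const
    · exact key h0
    · exact (key h0).neg
    · exact continuousAt_const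
  lift_sq a b z hz := by
    rw [stereoChart_trans]
    have h0 := zero_notMem_overlap a b z hz.2
    have key : z ≠ 0 → (Complex.I * conj z / (‖z‖ : ℂ)) ^ 2
        = deriv (fun z : ℂ => z⁻¹) z / (‖deriv (fun z : ℂ => z⁻¹) z‖ : ℂ) := by
      intro h
      have hz' : (‖z‖ : ℂ) ≠ 0 := by simpa using h
      rw [deriv_inv]
      simp only [norm_inv, norm_neg, norm_pow, Complex.ofReal_inv, Complex.ofReal_pow]
      have hn : conj z * z = (‖z‖ : ℂ) ^ 2 := Complex.conj_mul' z
      field_simp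
      rw [Complex.I_sq]
      linear_combination (-(conj z * z) - (‖z‖ : ℂ) ^ 2) * hn
    cases a <;> cases b <;> simp only [roundLift] <;> simp at h0
    · simp [stereoChange_self]
    · exact key h0
    · rw [neg_sq]; exact key h0
    · simp [stereoChange_self]
  lift_cocycle a b c z _ hb hc := by
    have : stereoChart b ((stereoChart a).symm z) = stereoChange a b z :=
      congrFun (stereoChart_trans a b) z
    rw [this]
    have h0 := zero_notMem_overlap a b z hb
    have key : z ≠ 0 → (Complex.I * conj z⁻¹ / (‖z⁻¹‖ : ℂ)) * (Complex.I * conj z / (‖z‖ : ℂ))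
        = -1 := by
      intro h
      have hz' : (‖z‖ : ℂ) ≠ 0 := by simpa using h
      have hc : conj z ≠ 0 := by simpa using h
      simp only [norm_inv, map_inv₀, Complex.ofReal_inv]
      field_simp
      exact Complex.I_sq
    cases a <;> cases b <;> cases c <;> simp only [roundLift, stereoChange] <;> simp at h0 <;>
      first
      | simp; done
      | linear_combination -(key h0)

/-! ## The explicit spinors on the plane -/

/-- The spinor `√2 (v + x · v) / (1 + |x|²)` on the plane. -/
def bubbleSpinor (v : Spinor) (x : ℂ) : Spinor :=
  (Real.sqrt 2 / (1 + ‖x‖ ^ 2)) • (v + cliff x v)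

end SuperLiouville

end

noncomputable section

namespace SuperLiouville

/-! ## Clifford algebra -/

/-! In a stereographic chart the connection form of `ρ² |dz|²`, `ρ = 2 / (1 + |z|²)`, is `-ρ (z ∧
X)`. Since `z · X = -⟪z, X⟫ + (z ∧ X) e₁e₂`, the Killing equation with constant `1/2` reads `dψ(X) =
(ρ/2) (X + z · X + ⟪z, X⟫) ψ` (`nabla_roundSphere_eq_iff`). The factor `√ρ` absorbs the scalar term:
`φ = √ρ ψ` satisfies the twistor-type equation `dφ(X) = (ρ/2) (1 + z) · X · φ`
(`hasFDerivAt_sqrt_smul`).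

Because `(1 - z)(1 + z) = 1 + |z|² = 2/ρ` in the Clifford algebra, `(1 - z) · φ` has zero
derivative, hence is a constant `√2 v`, and inverting `1 - z` gives `φ = ψ_v`
(`exists_eq_bubbleSpinor`). Conversely `ψ_v / √ρ` satisfies the Killing equation in the chart, and
`inversion_killingSpinor` matches two such local spinors over the overlap, giving a global section.

The systems then follow algebraically. A Killing spinor has `Dψ = -2cψ`, and `2 - 1 - 1 = 0` on the
sphere. On the plane, contracting the twistor-type equation with `∑ e_a z e_a = 0` gives `Dφ = -ρφ`,
while `Δ log ρ = -ρ²` and `|ψ_v|² = ρ` give the scalar equation. -/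

lemma conj_eq_re_sub_im (x : ℂ) : conj x = x.re - x.im * Complex.I := by
  apply Complex.ext <;> simp

lemma cliff_apply_zero (x : ℂ) (φ : Spinor) : cliff x φ 0 = x * φ 1 := by
  simp [cliff, act, gammaOne, gammaTwo, dotProduct, Fin.sum_univ_two]
  linear_combination φ 1 * Complex.re_add_im x

lemma cliff_apply_one (x : ℂ) (φ : Spinor) : cliff x φ 1 = -(conj x * φ 0) := by
  simp [cliff, act, gammaOne, gammaTwo, dotProduct, Fin.sum_univ_two]
  linear_combination φ 0 * conj_eq_re_sub_im x

lemma act_gamma_apply_zero (φ : Spinor) :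
    act gammaOne (act gammaTwo φ) 0 = Complex.I * φ 0 := by
  simp [act, gammaOne, gammaTwo, dotProduct, Fin.sum_univ_two]

lemma act_gamma_apply_one (φ : Spinor) :
    act gammaOne (act gammaTwo φ) 1 = -(Complex.I * φ 1) := by
  simp [act, gammaOne, gammaTwo, dotProduct, Fin.sum_univ_two]

lemma spinAct_apply_zero (s : ℂ) (φ : Spinor) : spinAct s φ 0 = s * φ 0 := by
  simp [spinAct, act, dotProduct, Fin.sum_univ_two]

lemma spinAct_apply_one (s : ℂ) (φ : Spinor) : spinAct s φ 1 = conj s * φ 1 := by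
  simp [spinAct, act, dotProduct, Fin.sum_univ_two]

lemma Spinor.ext' {φ χ : Spinor} (h0 : φ 0 = χ 0) (h1 : φ 1 = χ 1) : φ = χ := by
  ext k
  fin_cases k
  · exact h0
  · exact h1

lemma cliff_one (φ : Spinor) : cliff 1 φ = act gammaOne φ := by simp [cliff]

lemma cliff_I (φ : Spinor) : cliff Complex.I φ = act gammaTwo φ := by simp [cliff]

/-- Clifford multiplication as a continuous bilinear map. -/
def cliffL : ℂ →L[ℝ] Spinor →L[ℝ] Spinor :=
  LinearMap.toContinuousLinearMap
    ((LinearMap.toContinuousLinearMap : (Spinor →ₗ[ℝ] Spinor) ≃ₗ[ℝ] _).toLinearMap ∘ₗ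
      LinearMap.mk₂ ℝ cliff
        (fun x y φ => by
          apply Spinor.ext' <;> simp [cliff_apply_zero, cliff_apply_one] <;> ring)
        (fun r x φ => by
          apply Spinor.ext' <;> simp [cliff_apply_zero, cliff_apply_one] <;> ring)
        (fun x φ χ => by
          apply Spinor.ext' <;> simp [cliff_apply_zero, cliff_apply_one] <;> ring)
        (fun r x φ => by
          apply Spinor.ext' <;> simp [cliff_apply_zero, cliff_apply_one] <;> ring))

@[simp] lemma cliffL_apply (x : ℂ) (φ : Spinor) : cliffL x φ = cliff x φ := rfl

lemma cliff_add (x : ℂ) (φ χ : Spinor) : cliff x (φ + χ) = cliff x φ + cliff x χ := by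
  simp [← cliffL_apply]

lemma cliff_sub (x : ℂ) (φ χ : Spinor) : cliff x (φ - χ) = cliff x φ - cliff x χ := by
  simp [← cliffL_apply]

lemma cliff_smul (x : ℂ) (r : ℝ) (φ : Spinor) : cliff x (r • φ) = r • cliff x φ := by
  simp [← cliffL_apply]

lemma smul_cliff (r : ℝ) (x : ℂ) (φ : Spinor) : cliff (r • x) φ = r • cliff x φ := by
  simp only [← cliffL_apply, map_smul, smul_apply]

lemma cliff_smul_complex (x c : ℂ) (φ : Spinor) : cliff x (c • φ) = c • cliff x φ := by
  apply Spinor.ext' <;> simp [cliff_apply_zero, cliff_apply_one] <;> ring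

lemma cliff_cliff_self (x : ℂ) (φ : Spinor) : cliff x (cliff x φ) = -(‖x‖ ^ 2 • φ) := by
  have h := Complex.conj_mul' x
  apply Spinor.ext' <;> simp [cliff_apply_zero, cliff_apply_one]
  · linear_combination φ 0 * h
  · linear_combination φ 1 * h

/-- The symmetric part of the Clifford product is a scalar and the antisymmetric part a multiple of
`e₁e₂`; the latter is what the spin connection contributes. -/
lemma cliff_cliff (x y : ℂ) (φ : Spinor) :
    cliff x (cliff y φ)
      = -(⟪x, y⟫_ℝ • φ) + (x.re * y.im - x.im * y.re) • act gammaOne (act gammaTwo φ) := by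
  apply Spinor.ext' <;>
    simp [cliff_apply_zero, cliff_apply_one, act_gamma_apply_zero, act_gamma_apply_one,
      Complex.inner]
  · linear_combination (-x * φ 0) * conj_eq_re_sub_im y
      + (y.re - y.im * Complex.I) * φ 0 * Complex.re_add_im x
      + (x.im * y.im * φ 0) * Complex.I_sq
  · linear_combination (-y * φ 1) * conj_eq_re_sub_im x
      + (x.re - x.im * Complex.I) * φ 1 * Complex.re_add_im y
      + (x.im * y.im * φ 1) * Complex.I_sq

lemma cliff_anticomm (x y : ℂ) (φ : Spinor) :
    cliff x (cliff y φ) + cliff y (cliff x φ) = -((2 * ⟪x, y⟫_ℝ) • φ) := by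
  rw [cliff_cliff, cliff_cliff y x, real_inner_comm]
  module

/-- Clifford multiplication by `x` is skew for the real inner product and scales norms by `|x|`, so
the cross terms cancel. -/
lemma norm_sq_add_cliff (x : ℂ) (v : Spinor) :
    ‖v + cliff x v‖ ^ 2 = (1 + ‖x‖ ^ 2) * ‖v‖ ^ 2 := by
  simp only [EuclideanSpace.norm_sq_eq, Fin.sum_univ_two, PiLp.add_apply, cliff_apply_zero,
    cliff_apply_one, norm_sq_eq]
  simp
  ring

/-- In dimension two `∑ e_a x e_a = 0`. -/
lemma sum_gamma_cliff_gamma (x : ℂ) (φ : Spinor) :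
    cliff 1 (cliff x (cliff 1 φ)) + cliff Complex.I (cliff x (cliff Complex.I φ)) = 0 := by
  apply Spinor.ext' <;> simp [cliff_apply_zero, cliff_apply_one]
  · linear_combination -(conj x * φ 1) * Complex.I_sq
  · linear_combination (x * φ 0) * Complex.I_sq

/-- The Dirac operator of a Killing spinor with constant `c` is multiplication by `-2 c`. -/
lemma SpinorField.IsKilling.dirac_eq {M : Type*} [TopologicalSpace M] {S : SpinSurface M}
    {ψ : SpinorField S} {c : ℂ} (h : ψ.IsKilling c) (i : S.ι) {z : ℂ}
    (hz : z ∈ (S.chart i).target) : ψ.dirac i z = -((2 * c) • ψ.loc i z) := by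
  have hρ := (S.ρ_pos i z hz).ne'
  simp only [dirac, h.2 i z hz, SpinSurface.clifford, smul_smul, mul_inv_cancel₀ hρ, one_smul]
  rw [← cliff_one, ← cliff_I, cliff_smul_complex, cliff_smul_complex, cliff_cliff_self,
    cliff_cliff_self]
  simp
  module

/-! ## The conformal factor of the sphere -/

lemma roundFactor_pos (z : ℂ) : 0 < roundFactor z := div_pos two_pos (one_add_pos z)

lemma roundFactor_mul (z : ℂ) : roundFactor z * (1 + ‖z‖ ^ 2) = 2 :=
  div_mul_cancel₀ _ (one_add_pos z).ne'

/-- Writing the derivative through `ρ` itself keeps all later computations polynomial in `ρ` and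
`√ρ`, with the single relation `roundFactor_mul`. -/
lemma hasFDerivAt_roundFactor (z : ℂ) :
    HasFDerivAt roundFactor (-(roundFactor z ^ 2) • innerSL ℝ z) z := by
  have h0 := (one_add_pos z).ne'
  have h1 : HasFDerivAt (fun w : ℂ => 1 + ‖w‖ ^ 2) (2 • innerSL ℝ z) z :=
    (hasStrictFDerivAt_norm_sq z).hasFDerivAt.const_add 1
  have h2 := ((hasDerivAt_inv h0).comp_hasFDerivAt z h1).const_mul 2
  refine (h2.congr_of_eventuallyEq (.of_forall fun y => ?_)).congr_fderiv ?_
  · simp [roundFactor, div_eq_mul_inv]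
  · ext <;> · simp [roundFactor]; field_simp

lemma contDiff_roundFactor : ContDiff ℝ ∞ roundFactor :=
  contDiff_const.div (contDiff_const.add (contDiff_norm_sq ℝ)) fun z => (one_add_pos z).ne'

lemma hasFDerivAt_log_roundFactor (z : ℂ) :
    HasFDerivAt (fun w => Real.log (roundFactor w)) (-(roundFactor z) • innerSL ℝ z) z := by
  refine ((hasFDerivAt_roundFactor z).log (roundFactor_pos z).ne').congr_fderiv ?_
  rw [smul_smul]
  congr 1
  field_simp [(roundFactor_pos z).ne']

lemma fderiv_log_roundFactor :
    fderiv ℝ (fun w => Real.log (roundFactor w)) = fun z => -(roundFactor z) • innerSL ℝ z :=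
  funext fun z => (hasFDerivAt_log_roundFactor z).fderiv

lemma hasFDerivAt_sqrt_roundFactor (z : ℂ) :
    HasFDerivAt (fun w => √(roundFactor w))
      (-(roundFactor z * √(roundFactor z) / 2) • innerSL ℝ z) z := by
  have h0 := roundFactor_pos z
  refine ((hasFDerivAt_roundFactor z).sqrt h0.ne').congr_fderiv ?_
  rw [smul_smul]
  congr 1
  have h1 := Real.sqrt_pos.2 h0
  have h2 := Real.sq_sqrt h0.le
  field_simp
  rw [h2]

/-- Liouville's equation for the conformal factor of the round sphere. -/
lemma laplacian_log_roundFactor (z : ℂ) :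
    Laplacian.laplacian (fun w => Real.log (roundFactor w)) z = -(roundFactor z ^ 2) := by
  have h : HasFDerivAt (fun w => -(roundFactor w) • innerSL ℝ w) _ z :=
    (hasFDerivAt_roundFactor z).neg.smul (innerSL ℝ : ℂ →L[ℝ] ℂ →L[ℝ] ℝ).hasFDerivAt
  rw [InnerProductSpace.laplacian_eq_iteratedFDeriv_complexPlane]
  simp only [iteratedFDeriv_two_apply, fderiv_log_roundFactor, h.fderiv]
  have h1 := roundFactor_mul z
  rw [norm_sq_eq] at h1
  simp [Complex.inner, innerSL_apply_apply ℝ]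
  -- The trace of the Hessian is `ρ²|z|² - 2ρ`, which equals `-ρ²` because `ρ (1 + |z|²) = 2`.
  linear_combination roundFactor z * h1

/-! ## Killing spinors in a stereographic chart -/

lemma nabla_roundSphere_eq_iff (ψ : SpinorField roundSphere) (a : Pole) (z X : ℂ) :
    ψ.nabla a z X = (1 / 2 : ℂ) • roundSphere.clifford a z X (ψ.loc a z) ↔
      fderiv ℝ (ψ.loc a) z X = (roundFactor z / 2) • (cliff X (ψ.loc a z)
        + cliff z (cliff X (ψ.loc a z)) + ⟪z, X⟫_ℝ • ψ.loc a z) := by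
  have hω : roundSphere.connForm a z X = roundFactor z * (z.im * X.re - z.re * X.im) := by
    change -(fderiv ℝ (fun w => Real.log (roundFactor w)) z Complex.I) * X.re
      + fderiv ℝ (fun w => Real.log (roundFactor w)) z 1 * X.im = _
    rw [fderiv_log_roundFactor]
    simp [Complex.inner]
    ring
  have hc : (1 / 2 : ℂ) • roundSphere.clifford a z X (ψ.loc a z)
      = (roundFactor z / 2) • cliff X (ψ.loc a z) := by
    change (1 / 2 : ℂ) • cliff (roundFactor z • X) (ψ.loc a z) = _
    rw [smul_cliff, ← Complex.coe_smul, ← Complex.coe_smul, smul_smul]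
    congr 1
    push_cast
    ring
  change fderiv ℝ (ψ.loc a) z X
    + (roundSphere.connForm a z X / 2) • act gammaOne (act gammaTwo (ψ.loc a z)) = _ ↔ _
  rw [hω, hc, cliff_cliff z X, ← eq_sub_iff_add_eq]
  apply Eq.congr_right
  module

/-- Multiplication by `√ρ` turns the equation of a Killing spinor on the sphere into the one of a
twistor spinor on the plane. -/
lemma hasFDerivAt_sqrt_smul {f : ℂ → Spinor} {z : ℂ} (hf : DifferentiableAt ℝ f z)
    (hk : ∀ X, fderiv ℝ f z X = (roundFactor z / 2) • (cliff X (f z)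
        + cliff z (cliff X (f z)) + ⟪z, X⟫_ℝ • f z)) :
    HasFDerivAt (fun w => √(roundFactor w) • f w)
      ((roundFactor z / 2) • (cliffL.flip (√(roundFactor z) • f z)
        + (cliffL z).comp (cliffL.flip (√(roundFactor z) • f z)))) z := by
  refine ((hasFDerivAt_sqrt_roundFactor z).smul hf.hasFDerivAt).congr_fderiv ?_
  refine ContinuousLinearMap.ext fun X => ?_
  simp [hk]
  module

/-- The Killing spinor in a stereographic chart whose value at the centre is `v`. -/
def killingSpinor (v : Spinor) (z : ℂ) : Spinor := (√(roundFactor z) / √2) • (v + cliff z v)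

lemma contDiff_killingSpinor (v : Spinor) : ContDiff ℝ ∞ (killingSpinor v) := by
  refine ContDiff.smul (𝕜 := ℝ) (f := fun z => √(roundFactor z) / √2) ?_
    (contDiff_const.add (cliffL.flip v).contDiff)
  exact (contDiff_roundFactor.sqrt fun z => (roundFactor_pos z).ne').div_const _

lemma norm_killingSpinor (v : Spinor) (z : ℂ) : ‖killingSpinor v z‖ = ‖v‖ := by
  rw [← sq_eq_sq₀ (norm_nonneg _) (norm_nonneg _), killingSpinor, norm_smul, mul_pow,
    norm_sq_add_cliff, Real.norm_eq_abs, sq_abs, div_pow, Real.sq_sqrt (roundFactor_pos z).le,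
    Real.sq_sqrt two_pos.le]
  linear_combination (‖v‖ ^ 2 / 2) * roundFactor_mul z

lemma fderiv_killingSpinor (v : Spinor) (z X : ℂ) :
    fderiv ℝ (killingSpinor v) z X = (roundFactor z / 2) • (cliff X (killingSpinor v z)
        + cliff z (cliff X (killingSpinor v z)) + ⟪z, X⟫_ℝ • killingSpinor v z) := by
  have h := ((hasFDerivAt_sqrt_roundFactor z).mul_const (√2)⁻¹).smul
    ((cliffL.flip v).hasFDerivAt.const_add v)
  have h' : HasFDerivAt (killingSpinor v) _ z := h
  have h1 := cliff_anticomm z X v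
  -- Moving `z` past `X` and using `z · z = -|z|²` reduces the triple product, leaving only `v`, `X
  -- · v`, `z · v` and `z · X · v`; `h1` then eliminates the last in favour of `X · z · v` or
  -- conversely.
  have h2 : cliff z (cliff X (cliff z v)) = ‖z‖ ^ 2 • cliff X v - (2 * ⟪z, X⟫_ℝ) • cliff z v := by
    have h3 := cliff_anticomm z X (cliff z v)
    rw [cliff_cliff_self, ← neg_smul, cliff_smul] at h3
    rw [← sub_eq_zero] at h3 ⊢
    rw [← h3]
    module
  -- A factor `1 = ρ (1 + |z|²) / 2`, inserted once below so that both sides agree as polynomials in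
  -- `ρ`, `√ρ` and `|z|²`.
  have hρ : √(roundFactor z) = √(roundFactor z) * (roundFactor z * (1 + ‖z‖ ^ 2) / 2) := by
    rw [roundFactor_mul]; ring
  rw [h'.fderiv]
  simp only [killingSpinor, cliff_smul, cliff_add, h2]
  rw [eq_sub_of_add_eq' h1]
  simp
  nth_rw 1 [hρ]
  module

/-- Under `z ↦ z⁻¹` the weight `√ρ` gains a factor `|z|`, and `conj z * z = |z|²` turns `s (v₀ + z
v₁)` into `c |z| (v₁ + z⁻¹ v₀)`: the half-spinor components of the central value are exchanged. The
condition `conj c = -c`, met by `c = ± I`, makes the negative component match as well. -/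
lemma inversion_killingSpinor {z s : ℂ} (hz : z ≠ 0) (v : Spinor) {c : ℂ} (hc : conj c = -c)
    (hs : s = c * conj z / ‖z‖) :
    killingSpinor (WithLp.toLp 2 ![c * v 1, c * v 0]) z⁻¹ = spinAct s (killingSpinor v z) := by
  have hz' : ‖z‖ ≠ 0 := norm_ne_zero_iff.2 hz
  have hzc : (‖z‖ : ℂ) ≠ 0 := by simpa using hz
  have hρ : √(roundFactor z⁻¹) = ‖z‖ * √(roundFactor z) := by
    conv_rhs => rw [← Real.sqrt_sq (norm_nonneg z), ← Real.sqrt_mul (sq_nonneg _)]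
    congr 1
    simp only [roundFactor, norm_inv]
    have := one_add_pos z
    field_simp
    ring
  have hn : conj z * z = (‖z‖ : ℂ) ^ 2 := Complex.conj_mul' z
  have hcz : conj z ≠ 0 := by simpa using hz
  have h2 : (√2 : ℂ) ≠ 0 := by
    rw [Complex.ofReal_ne_zero]; positivity
  apply Spinor.ext'
  · rw [spinAct_apply_zero]
    simp [killingSpinor, hρ, cliff_apply_zero, hs]
    field_simp
    linear_combination √(roundFactor z) * c * (-(v 0) - z * v 1) * hn
  · rw [spinAct_apply_one]
    simp [killingSpinor, hρ, cliff_apply_one, hs, hc]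
    field_simp
    linear_combination √(roundFactor z) * c * (v 1 - conj z * v 0) * hn

/-- In the two stereographic charts a Killing spinor with constant `1 / 2` has the form
`killingSpinor v`, with the two central values related by the gluing of the charts. -/
def roundKillingLoc (v : Spinor) : Pole → ℂ → Spinor
  | .north => killingSpinor v
  | .south => killingSpinor (WithLp.toLp 2 ![Complex.I * v 1, Complex.I * v 0])

/-- The Killing spinor with constant `1 / 2` on the sphere whose value at the south pole is `v`. -/
def roundKilling (v : Spinor) : SpinorField roundSphere where
  loc := roundKillingLoc v
  glue a b z hz := by
    have h0 := zero_notMem_overlap a b z hz.2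
    change roundKillingLoc v b (stereoChart b ((stereoChart a).symm z))
      = spinAct (roundLift a b z) (roundKillingLoc v a z)
    have hone : ∀ φ : Spinor, φ = spinAct 1 φ := fun φ => by
      apply Spinor.ext' <;> simp [spinAct_apply_zero, spinAct_apply_one]
    rw [show stereoChart b ((stereoChart a).symm z) = stereoChange a b z from
      congrFun (stereoChart_trans a b) z]
    cases a <;> cases b <;> simp at h0
    · exact hone _
    · exact inversion_killingSpinor h0 v (c := Complex.I) (by simp) rfl
    -- The lift from south to north has the opposite sign, and `-I * I = 1` returns the original
    -- central value `v`.
    · refine Eq.trans ?_ (inversion_killingSpinor h0 _ (c := -Complex.I) (by simp) ?_)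
      · change killingSpinor v z⁻¹ = _
        congr 1
        apply Spinor.ext' <;> simp [← mul_assoc]
      · simp only [roundLift]
        ring
    · exact hone _

lemma isKilling_roundKilling (v : Spinor) : (roundKilling v).IsKilling (1 / 2) := by
  refine ⟨fun a => ?_, fun a z _ X => (nabla_roundSphere_eq_iff _ a z X).2 ?_⟩
  · cases a <;> exact (contDiff_killingSpinor _).contDiffOn
  · cases a <;> exact fderiv_killingSpinor _ z X

lemma unitNorm_roundKilling {v : Spinor} (hv : ‖v‖ = 1) : (roundKilling v).UnitNorm := by
  intro a z _
  cases a
  · exact (norm_killingSpinor _ _).trans hv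
  · refine (norm_killingSpinor _ _).trans ?_
    rw [← hv, ← sq_eq_sq₀ (norm_nonneg _) (norm_nonneg _), EuclideanSpace.norm_sq_eq,
      EuclideanSpace.norm_sq_eq, Fin.sum_univ_two, Fin.sum_univ_two]
    simp [add_comm]

/-! ### The explicit plane spinors as weighted Killing spinors. -/

lemma bubbleSpinor_eq (v : Spinor) (x : ℂ) :
    bubbleSpinor v x = √(roundFactor x) • killingSpinor v x := by
  have h := one_add_pos x
  rw [bubbleSpinor, killingSpinor, smul_smul, ← mul_div_assoc,
    Real.mul_self_sqrt (roundFactor_pos x).le, roundFactor]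
  congr 1
  have h2 := Real.sq_sqrt (two_pos.le : (0 : ℝ) ≤ 2)
  field_simp
  exact h2

lemma hasFDerivAt_bubbleSpinor (v : Spinor) (z : ℂ) :
    HasFDerivAt (bubbleSpinor v)
      ((roundFactor z / 2) • (cliffL.flip (bubbleSpinor v z)
        + (cliffL z).comp (cliffL.flip (bubbleSpinor v z)))) z := by
  rw [bubbleSpinor_eq, show bubbleSpinor v = _ from funext (bubbleSpinor_eq v)]
  exact hasFDerivAt_sqrt_smul
    ((contDiff_killingSpinor v).differentiable (by simp)).differentiableAt (fderiv_killingSpinor v z)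

lemma norm_sq_bubbleSpinor (v : Spinor) (z : ℂ) :
    ‖bubbleSpinor v z‖ ^ 2 = roundFactor z * ‖v‖ ^ 2 := by
  rw [bubbleSpinor_eq, norm_smul, norm_killingSpinor, mul_pow, Real.norm_eq_abs, sq_abs,
    Real.sq_sqrt (roundFactor_pos z).le]

/-- Since `(1 + x)(1 - x) = 1 + |x|²`, the inverse of `1 - x` is `(1 + x) / (1 + |x|²)`. -/
lemma eq_bubbleSpinor {v φ : Spinor} {x : ℂ} (h : φ - cliff x φ = √2 • v) :
    φ = bubbleSpinor v x := by
  have h1 : v = (√2)⁻¹ • (φ - cliff x φ) := by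
    rw [h, smul_smul, inv_mul_cancel₀ (by positivity), one_smul]
  have h0 := one_add_pos x
  have h2 : √2 ≠ 0 := by positivity
  rw [bubbleSpinor, h1, cliff_smul, cliff_sub, cliff_cliff_self, ← smul_add,
    show φ - cliff x φ + (cliff x φ - -(‖x‖ ^ 2 • φ)) = (1 + ‖x‖ ^ 2) • φ by module, smul_smul,
    smul_smul]
  field_simp
  simp

/-! ### Verification of the super-Liouville systems and classification. -/

lemma gaussCurvature_roundSphere (a : roundSphere.ι) (z : ℂ) : roundSphere.gaussCurvature a z = 1 := by
  change -((roundFactor z ^ 2)⁻¹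
    * Laplacian.laplacian (fun w => Real.log (roundFactor w)) z) = 1
  rw [laplacian_log_roundFactor]
  have := roundFactor_pos z
  field_simp

theorem isSolution_of_isKilling {ψ : SpinorField roundSphere} (hk : ψ.IsKilling (1 / 2))
    (hn : ψ.UnitNorm) : IsSolution roundSphere (fun _ => 0) ψ := by
  refine ⟨fun _ => contDiffOn_const, hk.1, fun a z hz => ⟨?_, ?_⟩⟩
  · rw [hn a z hz, gaussCurvature_roundSphere]
    simp only [SpinSurface.laplaceBeltrami, InnerProductSpace.laplacian_const]
    norm_num
  · rw [hk.dirac_eq a hz]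
    norm_num

theorem isSolution_bubbleSpinor {v : Spinor} (hv : ‖v‖ = 1) :
    IsSolution euclideanPlane (fun x => Real.log (2 / (1 + ‖x‖ ^ 2)))
      (planeField (bubbleSpinor v)) := by
  refine ⟨fun _ => ?_, fun _ => ?_, fun i z _ => ⟨?_, ?_⟩⟩
  · exact (contDiff_roundFactor.log fun z => (roundFactor_pos z).ne').contDiffOn
  · change ContDiffOn ℝ ∞ (bubbleSpinor v) _
    rw [show bubbleSpinor v = _ from funext (bubbleSpinor_eq v)]
    exact ((contDiff_roundFactor.sqrt fun z => (roundFactor_pos z).ne').smul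
      (contDiff_killingSpinor v)).contDiffOn
  · have h1 : euclideanPlane.laplaceBeltrami (fun x => Real.log (2 / (1 + ‖x‖ ^ 2))) i z
        = -(roundFactor z ^ 2) := by
      rw [← laplacian_log_roundFactor]
      simp [SpinSurface.laplaceBeltrami, euclideanPlane, roundFactor]
    have h2 : euclideanPlane.gaussCurvature i z = 0 := by
      simp [SpinSurface.gaussCurvature, euclideanPlane]
    rw [h1, h2]
    change _ = 2 * Real.exp (2 * Real.log (roundFactor z))
      - Real.exp (Real.log (roundFactor z)) * ‖bubbleSpinor v z‖ ^ 2 - 0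
    rw [two_mul (Real.log _), Real.exp_add, Real.exp_log (roundFactor_pos z),
      norm_sq_bubbleSpinor, hv]
    ring
  · change (planeField (bubbleSpinor v)).dirac i z
      = -(Real.exp (Real.log (roundFactor z)) • bubbleSpinor v z)
    have hn : ∀ X, (planeField (bubbleSpinor v)).nabla i z X
        = (roundFactor z / 2) • (cliff X (bubbleSpinor v z)
          + cliff z (cliff X (bubbleSpinor v z))) := by
      intro X
      have h1 : euclideanPlane.connForm i z X = 0 := by
        simp [SpinSurface.connForm, euclideanPlane]
      rw [SpinorField.nabla, h1]
      change fderiv ℝ (bubbleSpinor v) z X + _ = _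
      rw [(hasFDerivAt_bubbleSpinor v z).fderiv]
      simp
    -- The terms `e_a · z · e_a` cancel in the Dirac operator; the remaining `e_a · e_a = -1`,
    -- summed over `a`, give `-2 (ρ/2) = -ρ`.
    have hs := sum_gamma_cliff_gamma z (bubbleSpinor v z)
    rw [Real.exp_log (roundFactor_pos z), SpinorField.dirac, hn, hn, ← cliff_one, ← cliff_I]
    simp only [euclideanPlane, inv_one, one_smul, cliff_smul, cliff_add, cliff_cliff_self]
    rw [eq_neg_of_add_eq_zero_left hs]
    simp
    module

/-- A Killing spinor on the sphere is, up to the conformal weight, one of the explicit spinors. -/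
theorem exists_eq_bubbleSpinor {ψ : SpinorField roundSphere} (hk : ψ.IsKilling (1 / 2)) :
    ∃ v : Spinor, ∀ x, √(roundFactor x) • ψ.loc Pole.north x = bubbleSpinor v x := by
  set φ : ℂ → Spinor := fun x => √(roundFactor x) • ψ.loc Pole.north x with hφ
  have hd : Differentiable ℝ (ψ.loc Pole.north) :=
    (contDiffOn_univ.1 (hk.1 Pole.north)).differentiable (by simp)
  have hφ' : ∀ z, HasFDerivAt φ ((roundFactor z / 2) • (cliffL.flip (φ z)
      + (cliffL z).comp (cliffL.flip (φ z)))) z := fun z =>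
    hasFDerivAt_sqrt_smul (hd z) fun X =>
      (nabla_roundSphere_eq_iff ψ Pole.north z X).1 (hk.2 Pole.north z (Set.mem_univ z) X)
  -- The first integral `(1 - z) · φ`: its derivative is `(ρ/2)(1 - z)(1 + z) · X · φ - X · φ = 0`.
  have hconst : ∀ z, HasFDerivAt (fun w => φ w - cliff w (φ w)) (0 : ℂ →L[ℝ] Spinor) z := by
    intro z
    refine ((hφ' z).sub (cliffL.hasFDerivAt_of_bilinear (hasFDerivAt_id z) (hφ' z))).congr_fderiv ?_
    refine ContinuousLinearMap.ext fun X => ?_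
    have h := roundFactor_mul z
    simp [cliff_cliff_self]
    match_scalars
    · linear_combination h / 2
    · ring
  refine ⟨(√2)⁻¹ • (φ 0 - cliff 0 (φ 0)), fun x => eq_bubbleSpinor ?_⟩
  rw [smul_smul, mul_inv_cancel₀ (by positivity), one_smul]
  exact is_const_of_fderiv_eq_zero (𝕜 := ℝ) (fun z => (hconst z).differentiableAt)
    (fun z => (hconst z).fderiv) x 0

end SuperLiouville

end

theorem proposition3p2 :
    -- on the round sphere, every Killing spinor with Killing constant 1/2 and norm 1 gives a solution
    (∀ ψ : SuperLiouville.SpinorField SuperLiouville.roundSphere,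
      ψ.IsKilling (1 / 2) → ψ.UnitNorm →
        SuperLiouville.IsSolution SuperLiouville.roundSphere (fun _ => 0) ψ) ∧
    -- the explicit solutions on the plane
    (∀ v : SuperLiouville.Spinor, ‖v‖ = 1 →
      SuperLiouville.IsSolution SuperLiouville.euclideanPlane
        (fun x => Real.log (2 / (1 + ‖x‖ ^ 2)))
        (SuperLiouville.planeField (SuperLiouville.bubbleSpinor v))) ∧
    -- they are exactly the conformal images `(log ρ, √ρ ψ)` of the pairs `(0, ψ)` under the
    -- stereographic projection from the north pole, in which the round metric is `ρ² |dx|²`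
    (∀ φ : ℂ → SuperLiouville.Spinor,
      (∃ ψ : SuperLiouville.SpinorField SuperLiouville.roundSphere,
        ψ.IsKilling (1 / 2) ∧ ψ.UnitNorm ∧
          ∀ x : ℂ, φ x = Real.sqrt (2 / (1 + ‖x‖ ^ 2)) • ψ.loc SuperLiouville.Pole.north x) ↔
      ∃ v : SuperLiouville.Spinor, ‖v‖ = 1 ∧ φ = SuperLiouville.bubbleSpinor v) := by
  refine ⟨fun ψ hk hn => SuperLiouville.isSolution_of_isKilling hk hn,
    fun v hv => SuperLiouville.isSolution_bubbleSpinor hv, fun φ => ⟨?_, ?_⟩⟩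
  · rintro ⟨ψ, hk, hn, hφ⟩
    obtain ⟨v, hv⟩ := SuperLiouville.exists_eq_bubbleSpinor hk
    refine ⟨v, ?_, funext fun x => (hφ x).trans (hv x)⟩
    -- At the centre of the chart `√ρ` cancels, so `v` inherits its norm from `ψ` there.
    have h := hv 0
    rw [SuperLiouville.bubbleSpinor_eq] at h
    have h0 := Real.sqrt_pos.2 (SuperLiouville.roundFactor_pos 0)
    rw [← SuperLiouville.norm_killingSpinor v 0, ← smul_right_injective _ h0.ne' h]
    exact hn SuperLiouville.Pole.north 0 (Set.mem_univ _)
  · rintro ⟨v, hv, rfl⟩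
    exact ⟨SuperLiouville.roundKilling v, SuperLiouville.isKilling_roundKilling v,
      SuperLiouville.unitNorm_roundKilling hv, SuperLiouville.bubbleSpinor_eq v⟩
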